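/- **Conventions.** Let $\langle\cdot,\cdot\rangle:\mathbb N^2\to\mathbb N$ be a standard computable pairing bijection. For $p_0,p_1,\dots\in\mathbb N^{\mathbb N}$ let $\langle p_0,p_1,\dots\rangle\in\mathbb N^{\mathbb N}$ be given by $\langle p_0,p_1,\dots\rangle\langle i,k\rangle=p_i(k)$, and for $p,q\in\mathbb N^{\mathbb N}$ let $\langle p,q\rangle(2n)=p(n)$, $\langle p,q\rangle(2n+1)=q(n)$. A partial function $F:\subseteq\mathbb N^{\mathbb N}\to\mathbb N^{\mathbb N}$ is *computable* if a single oracle machine computes $F(p)$ from the oracle $p$ for every $p\in\mathrm{dom}(F)$. A *represented space* is a set $X$ with a surjective partial map $\delta_X:\subseteq\mathbb N^{\mathbb N}\to X$; if $\delta_X(p)=x$, then $p$ is a *name* of $x$. A *problem* $f:\subseteq X\rightrightarrows Y$ is a partial multi-valued function between represented spaces, with $\mathrm{dom}(f)=\{x\in X:f(x)\neq\emptyset\}$. A partial function $F:\subseteq\mathbb N^{\mathbb N}\to\mathbb N^{\mathbb N}$ *realizes* $f$, written $F\vdash f$, if $F$ is defined on every name $p$ of every $x\in\mathrm{dom}(f)$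 and $F(p)$ is then a name of some $y\in f(x)$. The problem $f$ is *Weihrauch reducible* to the problem $g$, written $f\leq_{\mathrm W}g$, if there are computable $H,K:\subseteq\mathbb N^{\mathbb N}\to\mathbb N^{\mathbb N}$ such that for every $G\vdash g$ the function $p\mapsto H\langle p,G(K(p))\rangle$ realizes $f$. **Problems.** - $\lim:\subseteq\mathbb N^{\mathbb N}\to\mathbb N^{\mathbb N}$, $\langle p_0,p_1,p_2,\dots\rangle\mapsto\lim_{i\to\infty}p_i$, where $\mathbb N^{\mathbb N}$ carries the product topology and is represented by the identity. - The *jump* $f'$ of a problem $f:\subseteq X\rightrightarrows Y$ is the same multi-valued function, with the representation $\delta_X$ of the input space replaced by $\delta_X\circ\lim$; $f^{(n)}$ is the $n$-fold jump of $f$. - $\mathsf{WKL}$ maps every infinite binary tree $T\subseteq\{0,1\}^*$ to the set of its infinite paths in $2^{\mathbb N}$. Trees are represented by their characteristic functions (with respect to a standard numbering of $\{0,1\}^*$), and $2^{\mathbb N}$ is represented as a subspace of $\mathbb N^{\mathbb N}$. - For $n,k\geq1$, let $[\mathbb N]^n$ be the set of $n$-element subsets of $\mathbb N$ and $\vartheta_n:\mathbb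 N\to[\mathbb N]^n$ a standard surjective numbering. A coloring $c:[\mathbb N]^n\to\{0,\dots,k-1\}$ is represented by $p\in\mathbb N^{\mathbb N}$ with $p(i)=c(\vartheta_n(i))$ for all $i$. The problem $\mathsf{RT}_{n,k}$ maps each such $c$ to the set of all infinite $M\subseteq\mathbb N$ that are homogeneous for $c$ (that is, $c$ is constant on the $n$-element subsets of $M$); $M$ is represented by its characteristic function in $2^{\mathbb N}$. - $\mathsf{SRT}_{n,k}$ is the restriction of $\mathsf{RT}_{n,k}$ to *stable* colorings, i.e. those for which $\lim_{i\to\infty}c(A\cup\{i\})$ exists for every $A\in[\mathbb N]^{n-1}$. **Corollary 3.20.** $\lim\leq_{\mathrm W}\mathsf{SRT}_{3,2}$ and $\mathsf{WKL}'\leq_{\mathrm W}\mathsf{RT}_{3,2}$. Moreover, $\mathsf{WKL}^{(n)}\leq_{\mathrm W}\mathsf{SRT}_{n+2,2}$ for all $n\geq2$. -/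

import Mathlib

open Filter Topology

/-! ### Computability on Baire space -/

/-- Baire space `ℕ^ℕ`, with its product topology. -/
abbrev Baire : Type := ℕ → ℕ

/-- The oracle-computable functionals `(p, n) ↦ Φ p n`, uniformly in the oracle `p : ℕ → ℕ`:
the partial recursive schemes, together with oracle queries `n ↦ p n`. -/
inductive OraclePartrec : (Baire → ℕ →. ℕ) → Prop
  | zero : OraclePartrec fun _ _ => Part.some 0
  | succ : OraclePartrec fun _ n => Part.some (n + 1)
  | left : OraclePartrec fun _ n => Part.some n.unpair.1
  | right : OraclePartrec fun _ n => Part.some n.unpair.2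
  | oracle : OraclePartrec fun p n => Part.some (p n)
  | pair {Φ Ψ : Baire → ℕ →. ℕ} (hΦ : OraclePartrec Φ) (hΨ : OraclePartrec Ψ) :
      OraclePartrec fun p n => Nat.pair <$> Φ p n <*> Ψ p n
  | comp {Φ Ψ : Baire → ℕ →. ℕ} (hΦ : OraclePartrec Φ) (hΨ : OraclePartrec Ψ) :
      OraclePartrec fun p n => Ψ p n >>= Φ p
  | prec {Φ Ψ : Baire → ℕ →. ℕ} (hΦ : OraclePartrec Φ) (hΨ : OraclePartrec Ψ) :
      OraclePartrec fun p => Nat.unpaired fun a n =>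
        n.rec (Φ p a) fun y IH => do
          let i ← IH
          Ψ p (Nat.pair a (Nat.pair y i))
  | rfind {Φ : Baire → ℕ →. ℕ} (hΦ : OraclePartrec Φ) :
      OraclePartrec fun p a => Nat.rfind fun n => (fun m => m = 0) <$> Φ p (Nat.pair a n)

/-- A partial function `F :⊆ ℕ^ℕ → ℕ^ℕ` is computable if a single oracle procedure computes,
for every `p ∈ dom F`, the sequence `F(p)` from the oracle `p`. -/
def ComputableOnBaire (F : Baire →. Baire) : Prop :=
  ∃ Φ, OraclePartrec Φ ∧ ∀ p, ∀ q ∈ F p, ∀ n, q n ∈ Φ p n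

/-- The pair `⟨p, q⟩` of points of Baire space: `⟨p, q⟩(2n) = p(n)`, `⟨p, q⟩(2n+1) = q(n)`. -/
def bairePair (p q : Baire) : Baire :=
  fun n => if n % 2 = 0 then p (n / 2) else q (n / 2)

/-- The components `p₀, p₁, p₂, …` of `p = ⟨p₀, p₁, p₂, …⟩`, where `⟨p₀, p₁, …⟩⟨i, k⟩ = pᵢ(k)`. -/
def baireRow (p : Baire) (i : ℕ) : Baire :=
  fun k => p (Nat.pair i k)

/-! ### Represented spaces, problems, Weihrauch reducibility -/

/-- A representation `δ :⊆ ℕ^ℕ → X`, a surjective partial map, given by its graph: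
`IsName p x` means `δ(p) = x`. -/
structure NamingSystem (X : Type) where
  IsName : Baire → X → Prop
  unique : ∀ p x y, IsName p x → IsName p y → x = y
  surjective : ∀ x, ∃ p, IsName p x

/-- The jump `δ' = δ ∘ lim` of a representation. -/
def NamingSystem.jump {X : Type} (δ : NamingSystem X) : NamingSystem X where
  IsName p x := ∃ q, Tendsto (baireRow p) atTop (𝓝 q) ∧ δ.IsName q x
  unique := by
    rintro p x y ⟨q, hq, hx⟩ ⟨r, hr, hy⟩
    rw [tendsto_nhds_unique hr hq] at hy
    exact δ.unique q x y hx hy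
  surjective := by
    intro x
    obtain ⟨q, hq⟩ := δ.surjective x
    refine ⟨fun m => q m.unpair.2, q, ?_, hq⟩
    have h : baireRow (fun m => q m.unpair.2) = fun _ => q := by
      funext i k
      simp [baireRow]
    rw [h]
    exact tendsto_const_nhds

/-- A problem `f :⊆ X ⇉ Y`, a partial multi-valued function on represented spaces. -/
structure Problem where
  X : Type
  Y : Type
  inRep : NamingSystem X
  outRep : NamingSystem Y
  sol : X → Set Y

/-- `dom(f) = {x : f(x) ≠ ∅}`. -/
def Problem.dom (f : Problem) : Set f.X := {x | (f.sol x).Nonempty}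

/-- `F ⊢ f`: the partial function `F :⊆ ℕ^ℕ → ℕ^ℕ` maps every name of every `x ∈ dom(f)` to a
name of some point of `f(x)`. -/
def Realizes (F : Baire →. Baire) (f : Problem) : Prop :=
  ∀ p, ∀ x ∈ f.dom, f.inRep.IsName p x → ∃ q ∈ F p, ∃ y ∈ f.sol x, f.outRep.IsName q y

/-- `f ≤_W g`: there are computable `H, K :⊆ ℕ^ℕ → ℕ^ℕ` such that `H⟨id, G K⟩ ⊢ f` for all
`G ⊢ g`. -/
def WeihrauchReducible (f g : Problem) : Prop :=
  ∃ H K : Baire →. Baire, ComputableOnBaire H ∧ ComputableOnBaire K ∧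
    ∀ G : Baire →. Baire, Realizes G g →
      Realizes (fun p => (K p).bind fun r => (G r).bind fun q => H (bairePair p q)) f

/-- The jump `f'` of a problem: the same problem, with the jump of the input representation. -/
def Problem.jump (f : Problem) : Problem where
  X := f.X
  Y := f.Y
  inRep := f.inRep.jump
  outRep := f.outRep
  sol := f.sol

/-- The `n`-fold jump `f^(n)`. -/
def Problem.iterJump (f : Problem) (n : ℕ) : Problem := Problem.jump^[n] f

/-! ### The limit problem -/

/-- Baire space represented by the identity. -/
def baireRep : NamingSystem Baire where
  IsName p x := p = x
  unique := by
    rintro p x y rfl rfl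
    rfl
  surjective x := ⟨x, rfl⟩

/-- `lim :⊆ ℕ^ℕ → ℕ^ℕ, ⟨p₀, p₁, p₂, …⟩ ↦ lim pᵢ`. -/
def limProblem : Problem where
  X := Baire
  Y := Baire
  inRep := baireRep
  outRep := baireRep
  sol p := {q | Tendsto (baireRow p) atTop (𝓝 q)}

/-! ### Weak Kőnig's lemma -/

/-- Cantor space `2^ℕ`, represented as a subspace of Baire space. -/
def cantorRep : NamingSystem (ℕ → Bool) where
  IsName p x := ∀ i, p i = (x i).toNat
  unique := by
    intro p x y hx hy
    funext i
    have h := (hx i).symm.trans (hy i)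
    cases hxi : x i <;> cases hyi : y i <;> simp_all
  surjective x := ⟨fun i => (x i).toNat, fun _ => rfl⟩

/-- A binary tree: a set of finite binary words that is closed under prefixes. -/
structure BinWordTree where
  nodes : Set (List Bool)
  closed : ∀ u v : List Bool, u <+: v → v ∈ nodes → u ∈ nodes

/-- The length-lexicographic numbering of the binary words:
`[] ↦ 0` and `w ++ [b] ↦ 2 * code w + 1 + b`. -/
def wordCode (w : List Bool) : ℕ := w.foldl (fun a b => 2 * a + 1 + b.toNat) 0

theorem wordCode_append (w : List Bool) (b : Bool) :
    wordCode (w ++ [b]) = 2 * wordCode w + 1 + b.toNat := by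
  simp [wordCode, List.foldl_append]

theorem wordCode_injective : Function.Injective wordCode := by
  intro u
  induction u using List.reverseRecOn with
  | nil =>
    intro v h
    rcases List.eq_nil_or_concat v with rfl | ⟨w, b, rfl⟩
    · rfl
    · rw [List.concat_eq_append, wordCode_append] at h
      simp [wordCode] at h
      omega
  | append_singleton u a ih =>
    intro v h
    rcases List.eq_nil_or_concat v with rfl | ⟨w, b, rfl⟩
    · rw [wordCode_append] at h
      simp [wordCode] at h
    · rw [List.concat_eq_append, wordCode_append, wordCode_append] at h
      have ha := Bool.toNat_le a
      have hb := Bool.toNat_le b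
      have h1 : wordCode u = wordCode w := by omega
      have h2 : a = b := by
        cases a <;> cases b <;> simp at h ⊢ <;> omega
      rw [ih h1, h2, List.concat_eq_append]

open Classical in
/-- The space `Tr` of binary trees; a tree is represented by its characteristic function. -/
noncomputable def treeRep : NamingSystem BinWordTree where
  IsName p T := ∀ w, p (wordCode w) = if w ∈ T.nodes then 1 else 0
  unique := by
    rintro p ⟨S, hS⟩ ⟨T, hT⟩ h h'
    have : S = T := by
      ext w
      have := (h w).symm.trans (h' w)
      by_cases h1 : w ∈ S <;> by_cases h2 : w ∈ T <;> simp_all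
    subst this
    rfl
  surjective T := by
    refine ⟨fun m => if ∃ w ∈ T.nodes, wordCode w = m then 1 else 0, fun w => ?_⟩
    have : (∃ v ∈ T.nodes, wordCode v = wordCode w) ↔ w ∈ T.nodes :=
      ⟨fun ⟨v, hv, h⟩ => wordCode_injective h ▸ hv, fun h => ⟨w, h, rfl⟩⟩
    simp only [this]

/-- `WKL :⊆ Tr ⇉ 2^ℕ` maps every infinite binary tree to the set of its infinite paths. -/
noncomputable def WKL : Problem where
  X := BinWordTree
  Y := ℕ → Bool
  inRep := treeRep
  outRep := cantorRep
  sol T := {x | T.nodes.Infinite ∧ ∀ m, (List.range m).map x ∈ T.nodes}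

/-! ### Ramsey's theorem -/

/-- The set of colorings `c : [ℕ]^n → k`. -/
abbrev Coloring (n k : ℕ) : Type := Set.powersetCard ℕ n → Fin k

/-- The standard numbering of the `n`-element subsets of `ℕ`: the code `⟨i₀, …, i_{n-1}⟩` denotes
`{i₀ < i₀ + i₁ + 1 < i₀ + i₁ + i₂ + 2 < …}`. -/
def subsetNumbering : ℕ → ℕ → Finset ℕ
  | 0, _ => ∅
  | 1, i => {i}
  | n + 2, e =>
      insert e.unpair.1 ((subsetNumbering (n + 1) e.unpair.2).image (· + (e.unpair.1 + 1)))

theorem card_subsetNumbering : ∀ n e, (subsetNumbering n e).card = n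
  | 0, _ => rfl
  | 1, _ => rfl
  | n + 2, e => by
      rw [subsetNumbering, Finset.card_insert_of_notMem, Finset.card_image_of_injective,
        card_subsetNumbering (n + 1)]
      · exact add_left_injective _
      · simp only [Finset.mem_image, not_exists, not_and]
        intro x _ h
        omega

theorem subsetNumbering_surjective :
    ∀ n (A : Finset ℕ), A.card = n → ∃ e, subsetNumbering n e = A
  | 0, A, h => ⟨0, (Finset.card_eq_zero.mp h).symm⟩
  | 1, A, h => by
      obtain ⟨a, rfl⟩ := Finset.card_eq_one.mp h
      exact ⟨a, rfl⟩
  | n + 2, A, h => by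
      have hne : A.Nonempty := Finset.card_pos.mp (by omega)
      set a := A.min' hne with ha
      have hlt : ∀ x ∈ A.erase a, a < x := fun x hx =>
        Finset.min'_lt_of_mem_erase_min' A hne hx
      obtain ⟨e, he⟩ := subsetNumbering_surjective (n + 1)
        ((A.erase a).image (· - (a + 1))) (by
          rw [Finset.card_image_of_injOn, Finset.card_erase_of_mem (A.min'_mem hne), h]
          · rfl
          · intro x hx y hy hxy
            have h1 := hlt x hx
            have h2 := hlt y hy
            simp only at hxy
            omega)
      refine ⟨Nat.pair a e, ?_⟩
      have hid : ((A.erase a).image (· - (a + 1))).image (· + (a + 1)) = A.erase a := by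
        ext x
        simp only [Finset.mem_image, exists_exists_and_eq_and]
        constructor
        · rintro ⟨y, hy, rfl⟩
          have := hlt y hy
          rwa [Nat.sub_add_cancel this]
        · intro hx
          exact ⟨x, hx, Nat.sub_add_cancel (hlt x hx)⟩
      rw [subsetNumbering, Nat.unpair_pair, he, hid, Finset.insert_erase (A.min'_mem hne)]

/-- The numbering `ϑ_n : ℕ → [ℕ]^n`. -/
def theta (n i : ℕ) : Set.powersetCard ℕ n := ⟨subsetNumbering n i, card_subsetNumbering n i⟩

/-- The represented space of colorings: `p` is a name of `c` if `p(i) = c(ϑ_n(i))` for all `i`. -/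
def coloringRep (n k : ℕ) : NamingSystem (Coloring n k) where
  IsName p c := ∀ i, p i = (c (theta n i) : ℕ)
  unique := by
    intro p c d hc hd
    funext A
    obtain ⟨e, he⟩ := subsetNumbering_surjective n A.1 A.2
    have hA : theta n e = A := Subtype.ext he
    rw [← hA]
    exact Fin.ext ((hc e).symm.trans (hd e))
  surjective c := ⟨fun i => (c (theta n i) : ℕ), fun _ => rfl⟩

/-- `M ∈ H_c`: the set `M` is infinite and homogeneous for `c`. -/
def IsInfiniteHomogeneous {n k : ℕ} (c : Coloring n k) (M : Set ℕ) : Prop :=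
  M.Infinite ∧ ∃ a : Fin k, ∀ A : Set.powersetCard ℕ n, (A.1 : Set ℕ) ⊆ M → c A = a

/-- A coloring `c` is stable if `lim_{i → ∞} c(A ∪ {i})` exists for all `A ∈ [ℕ]^(n-1)`
(for all large `i`, the set `A ∪ {i}` has `n` elements). -/
def IsStable {n k : ℕ} (c : Coloring n k) : Prop :=
  ∀ A : Finset ℕ, A.card + 1 = n → ∃ a : Fin k, ∀ᶠ i in atTop,
    ∀ h : insert i A ∈ Set.powersetCard ℕ n, c ⟨insert i A, h⟩ = a

/-- `RT_{n,k} : C_{n,k} ⇉ 2^ℕ`, `c ↦ H_c`; a set is identified with its characteristic function. -/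
def RT (n k : ℕ) : Problem where
  X := Coloring n k
  Y := ℕ → Bool
  inRep := coloringRep n k
  outRep := cantorRep
  sol c := {x | IsInfiniteHomogeneous c {i | x i = true}}

/-- `SRT_{n,k}`: the restriction of `RT_{n,k}` to stable colorings. -/
def SRT (n k : ℕ) : Problem where
  X := Coloring n k
  Y := ℕ → Bool
  inRep := coloringRep n k
  outRep := cantorRep
  sol c := {x | IsStable c ∧ IsInfiniteHomogeneous c {i | x i = true}}

/-! ### Oracle computability toolkit -/

namespace OraclePartrec

/-! All three reductions are instances of one construction, `weihrauchReducible_of_iterated_limit`.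
Suppose the input computes points `W [z₀, …, zₘ]` of Baire space whose iterated limit over `z₁, …,
zₘ` is `V z₀`, where each coordinate of `V` takes only finitely many values, and every limit of `V`
along an infinite set names a solution. Color `{a < z₀ < ⋯ < z_{m+1}}` by whether the windows `[z₀,
…, zₘ]` and `[z₁, …, z_{m+1}]` give the same values of `W` below `a`. This coloring of `(m+3)`-sets
is computable.

Let `M` be infinite and homogeneous. Its color must be agreement: by pigeonhole, two values `V z₀`,
`V z₁` with `z₀, z₁ ∈ M` agree below a given `a ∈ M`, and the remaining elements can be taken so far
out in `M` that the windows reproduce these values (`agree_of_homogeneous`). Sliding windows along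
`M` then shows that `W zs i` is the same for all windows `zs` in `M` lying beyond some element of
`M` above `i`. The common value is computable from `W` and `M`, and it is the limit of `V` along `M`
(`exists_limit_of_homogeneous`).

For `lim`, take `m = 0` and let `W [z]` be the `z`-th row of the input. For the `(m+1)`-st jump of
`WKL`, the index `z₀` runs through approximations to the tree and `z₁, …, zₘ` approximate these
approximations; `W` is the branch of greatest code up to `z₀`. Limits of such branches along `M` are
paths. The coloring is stable once `W` converges in its last index. This holds for `lim` because the
rows converge, and for the jumps of `WKL` when `m > 0`, because the search for a branch is then
bounded by an index already fixed. -/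

theorem of_eq {Φ Ψ : Baire → ℕ →. ℕ} (hΦ : OraclePartrec Φ) (h : ∀ p n, Φ p n = Ψ p n) :
    OraclePartrec Ψ := by
  have : Φ = Ψ := by
    funext p n
    exact h p n
  exact this ▸ hΦ

/-- Every partial recursive function is oracle-computable, with an oracle that is never queried. -/
theorem of_partrec {f : ℕ →. ℕ} (hf : Nat.Partrec f) : OraclePartrec fun _ => f := by
  induction hf with
  | zero => exact zero
  | succ => exact succ
  | left => exact left
  | right => exact right
  | pair _ _ ihf ihg => exact pair ihf ihg
  | comp _ _ ihf ihg => exact comp ihf ihg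
  | prec _ _ ihf ihg => exact prec ihf ihg
  | rfind _ ihf => exact rfind ihf

theorem of_primrec {f : ℕ → ℕ} (hf : Primrec f) : OraclePartrec fun _ n => Part.some (f n) :=
  of_partrec (Nat.Partrec.of_primrec (Primrec.nat_iff.mp hf))

theorem pair_total {F G : Baire → ℕ → ℕ} (hF : OraclePartrec fun p n => Part.some (F p n))
    (hG : OraclePartrec fun p n => Part.some (G p n)) :
    OraclePartrec fun p n => Part.some (Nat.pair (F p n) (G p n)) :=
  (pair hF hG).of_eq fun p n => by simp [Seq.seq]

theorem comp_total {F G : Baire → ℕ → ℕ} (hF : OraclePartrec fun p n => Part.some (F p n))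
    (hG : OraclePartrec fun p n => Part.some (G p n)) :
    OraclePartrec fun p n => Part.some (F p (G p n)) :=
  (comp hF hG).of_eq fun p n => by simp

/-- The finite initial segments of the oracle are computable. -/
theorem initialSegment :
    OraclePartrec fun p n => Part.some (Encodable.encode ((List.range n).map p)) := by
  -- The accumulator of the recursion is the code of the segment read so far; `m` packs it with the
  -- next oracle value.
  let step : ℕ → ℕ := fun m =>
    Encodable.encode (((Encodable.decode (α := List ℕ) m.unpair.1).getD []) ++ [m.unpair.2])
  have hstep : Primrec step := by
    refine Primrec.encode.comp (Primrec.list_concat.comp ?_ ?_)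
    · exact Primrec.option_getD.comp
        (Primrec.decode.comp (Primrec.fst.comp Primrec.unpair)) (Primrec.const [])
    · exact Primrec.snd.comp Primrec.unpair
  have hy : Primrec fun n : ℕ => n.unpair.2.unpair.1 :=
    Primrec.fst.comp (Primrec.unpair.comp (Primrec.snd.comp Primrec.unpair))
  have hi : Primrec fun n : ℕ => n.unpair.2.unpair.2 :=
    Primrec.snd.comp (Primrec.unpair.comp (Primrec.snd.comp Primrec.unpair))
  have h := comp_total (of_primrec hstep)
    (pair_total (of_primrec hi) (comp_total oracle (of_primrec hy)))
  have h' := prec (of_primrec (Primrec.const (Encodable.encode ([] : List ℕ)))) h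
  have hz : Primrec fun n : ℕ => Nat.pair 0 n := Primrec₂.natPair.comp (Primrec.const 0) Primrec.id
  refine (comp h' (of_primrec hz)).of_eq fun p n => ?_
  simp only [Nat.unpaired, Part.bind_eq_bind, Part.bind_some, Nat.unpair_pair]
  induction n with
  | zero => simp
  | succ n ih =>
    simp only [ih, Part.bind_some]
    simp [step, List.range_succ]

/-- The functional that answers `n` by the first value that `g n` yields on an initial segment of
the oracle. -/
theorem search {g : ℕ → List ℕ → Option ℕ} (hg : Primrec₂ g) :
    ∃ Φ, OraclePartrec Φ ∧ ∀ (p : Baire) (n v : ℕ),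
      (∃ N, (g n ((List.range N).map p)).isSome) →
      (∀ N w, g n ((List.range N).map p) = some w → w = v) → v ∈ Φ p n := by
  let seg : ℕ → List ℕ := fun m => (Encodable.decode (α := List ℕ) m.unpair.2).getD []
  have hseg : Primrec seg := Primrec.option_getD.comp
    (Primrec.decode.comp (Primrec.snd.comp Primrec.unpair)) (Primrec.const [])
  have hval : Primrec fun m : ℕ => g m.unpair.1 (seg m) :=
    hg.comp (Primrec.fst.comp Primrec.unpair) hseg
  -- Unbounded search looks for a zero, so success is coded by `0`.
  have htest : Primrec fun m : ℕ => bif (g m.unpair.1 (seg m)).isSome then 0 else 1 :=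
    Primrec.cond (Primrec.option_isSome.comp hval) (Primrec.const 0) (Primrec.const 1)
  have hout : Primrec fun m : ℕ => (g m.unpair.1 (seg m)).getD 0 :=
    Primrec.option_getD.comp hval (Primrec.const 0)
  have hload : OraclePartrec fun p m => Part.some (Nat.pair m.unpair.1
      (Encodable.encode ((List.range m.unpair.2).map p))) :=
    pair_total left (comp_total initialSegment right)
  have hfind := rfind (comp_total (of_primrec htest) hload)
  have hid : OraclePartrec fun _ n => Part.some n := of_primrec Primrec.id
  refine ⟨_, comp (comp_total (of_primrec hout) hload) (pair hid hfind), fun p n v hN hv => ?_⟩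
  have hdom : ∃ N, (g n ((List.range N).map p)).isSome = true := hN
  have hfst := Nat.find_spec hdom
  set N := Nat.find hdom with hNdef
  obtain ⟨w, hw⟩ := Option.isSome_iff_exists.mp hfst
  have hmem : N ∈ Nat.rfind fun N => (fun m => decide (m = 0)) <$> Part.some
      (bif (g n ((List.range N).map p)).isSome then 0 else 1) := by
    refine Nat.mem_rfind.mpr ⟨by simp [hw], fun {k} hk => ?_⟩
    have := Nat.find_min hdom hk
    simp only [Bool.not_eq_true] at this
    simp [this]
  simp only [Nat.unpair_pair, Part.bind_eq_bind, seg, Encodable.encodek, Option.getD_some,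
    Part.mem_bind_iff]
  refine ⟨Nat.pair n N, ?_, ?_⟩
  · simp only [Seq.seq, Part.map_eq_map, Part.map_some, Part.bind_some, Part.mem_map_iff]
    refine ⟨N, ?_, rfl⟩
    simpa using hmem
  · simp [hw, hv N w hw]

/-- A functional that inspects the oracle only at the places listed by `Q n` is computable. -/
theorem of_queries {Q : ℕ → List ℕ} {f : ℕ → List ℕ → ℕ} (hQ : Primrec Q) (hf : Primrec₂ f)
    {F : Baire → ℕ → ℕ}
    (h : ∀ (p : Baire) (n : ℕ) (l : List ℕ), (∀ k ∈ Q n, l[k]? = some (p k)) → f n l = F p n) :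
    ∃ Φ, OraclePartrec Φ ∧ ∀ p n, F p n ∈ Φ p n := by
  have hlt : PrimrecPred fun x : List ℕ × ℕ => ∀ k ∈ x.1, k < x.2 :=
    PrimrecRel.forall_mem_list Primrec.nat_lt
  have hg : Primrec₂ fun (n : ℕ) (l : List ℕ) =>
      if ∀ k ∈ Q n, k < l.length then some (f n l) else none :=
    Primrec.ite (hlt.comp ((hQ.comp Primrec.fst).pair (Primrec.list_length.comp Primrec.snd)))
      (Primrec.option_some.comp hf) (Primrec.const none)
  obtain ⟨Φ, hΦ, hmem⟩ := search hg
  refine ⟨Φ, hΦ, fun p n => hmem p n _ ?_ ?_⟩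
  -- Any initial segment long enough to contain all queried places makes the search stop.
  · obtain ⟨b, hb⟩ := (Q n).toFinset.exists_nat_subset_range
    refine ⟨b, ?_⟩
    rw [if_pos]
    · rfl
    · intro k hk
      simpa using hb (List.mem_toFinset.mpr hk)
  · intro N w hw
    split_ifs at hw with hN
    cases hw
    refine h p n _ fun k hk => ?_
    have := hN k hk
    simp only [List.length_map, List.length_range] at this
    simp [this]

/-- Substitution of a computed oracle. -/
theorem substitute {Φ Ψ : Baire → ℕ →. ℕ} (hΨ : OraclePartrec Ψ) (hΦ : OraclePartrec Φ) :
    ∃ Θ, OraclePartrec Θ ∧ ∀ p q : Baire, (∀ n, q n ∈ Φ p n) → Θ p = Ψ q := by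
  induction hΨ with
  | zero => exact ⟨_, zero, fun _ _ _ => rfl⟩
  | succ => exact ⟨_, succ, fun _ _ _ => rfl⟩
  | left => exact ⟨_, left, fun _ _ _ => rfl⟩
  | right => exact ⟨_, right, fun _ _ _ => rfl⟩
  | oracle => exact ⟨_, hΦ, fun p q h => funext fun n => Part.eq_some_iff.mpr (h n)⟩
  | pair _ _ ih₁ ih₂ =>
    obtain ⟨Θ₁, h₁, e₁⟩ := ih₁
    obtain ⟨Θ₂, h₂, e₂⟩ := ih₂
    exact ⟨_, pair h₁ h₂, fun p q h => by simp only [e₁ p q h, e₂ p q h]; rfl⟩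
  | comp _ _ ih₁ ih₂ =>
    obtain ⟨Θ₁, h₁, e₁⟩ := ih₁
    obtain ⟨Θ₂, h₂, e₂⟩ := ih₂
    exact ⟨_, comp h₁ h₂, fun p q h => by simp only [e₁ p q h, e₂ p q h]; rfl⟩
  | prec _ _ ih₁ ih₂ =>
    obtain ⟨Θ₁, h₁, e₁⟩ := ih₁
    obtain ⟨Θ₂, h₂, e₂⟩ := ih₂
    exact ⟨_, prec h₁ h₂, fun p q h => by simp only [e₁ p q h, e₂ p q h]; rfl⟩
  | rfind _ ih =>
    obtain ⟨Θ, h, e⟩ := ih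
    exact ⟨_, rfind h, fun p q h => by simp only [e p q h]; rfl⟩

/-- Applying a computable functional to the first component of a pair. -/
theorem map_bairePair_left {Φ : Baire → ℕ →. ℕ} (hΦ : OraclePartrec Φ) :
    ∃ Θ, OraclePartrec Θ ∧ ∀ p p' q : Baire, (∀ n, p' n ∈ Φ p n) →
      ∀ n, bairePair p' q n ∈ Θ (bairePair p q) n := by
  have hdouble : OraclePartrec fun p n => Part.some (p (2 * n)) :=
    comp_total oracle (of_primrec (Primrec.nat_mul.comp (Primrec.const 2) Primrec.id))
  obtain ⟨Φ', hΦ', e⟩ := hΦ.substitute hdouble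
  let sel : ℕ → ℕ := fun m =>
    if m.unpair.1 % 2 = 0 then m.unpair.2.unpair.1 else m.unpair.2.unpair.2
  have hsnd : Primrec fun m : ℕ => m.unpair.2.unpair :=
    Primrec.unpair.comp (Primrec.snd.comp Primrec.unpair)
  have hsel : Primrec sel := Primrec.ite
    (Primrec.eq.comp (Primrec.nat_mod.comp (Primrec.fst.comp Primrec.unpair) (Primrec.const 2))
      (Primrec.const 0))
    (Primrec.fst.comp hsnd) (Primrec.snd.comp hsnd)
  have hhalf : OraclePartrec fun _ n => Part.some (n / 2) :=
    of_primrec (Primrec.nat_div.comp Primrec.id (Primrec.const 2))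
  have hid : OraclePartrec fun _ n => Part.some n := of_primrec Primrec.id
  refine ⟨_, comp (of_primrec hsel) (pair hid (pair (comp hΦ' hhalf) oracle)),
    fun p p' q hp n => ?_⟩
  have hsub : Φ' (bairePair p q) = Φ p := e _ p fun n => by
    have h1 : 2 * n % 2 = 0 := by omega
    have h2 : 2 * n / 2 = n := by omega
    simp [bairePair, h1, h2]
  have hval : (Part.some (n / 2) >>= Φ p) = Part.some (p' (n / 2)) :=
    (Part.bind_some _ _).trans (Part.eq_some_iff.mpr (hp _))
  by_cases hn : n % 2 = 0 <;>
  simp [hsub, hval, Seq.seq, sel, bairePair, hn]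

end OraclePartrec

/-- The partial function on Baire space that is computed by an oracle procedure. -/
def computedFunction (Φ : Baire → ℕ →. ℕ) : Baire →. Baire :=
  fun p => ⟨∀ n, (Φ p n).Dom, fun h n => (Φ p n).get (h n)⟩

theorem mem_computedFunction {Φ : Baire → ℕ →. ℕ} {p q : Baire} :
    q ∈ computedFunction Φ p ↔ ∀ n, q n ∈ Φ p n := by
  constructor
  · rintro ⟨h, rfl⟩ n
    exact Part.get_mem _
  · intro h
    exact ⟨fun n => Part.dom_iff_mem.mpr ⟨_, h n⟩, funext fun n => Part.get_eq_of_mem (h n) _⟩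

theorem computableOnBaire_computedFunction {Φ : Baire → ℕ →. ℕ} (hΦ : OraclePartrec Φ) :
    ComputableOnBaire (computedFunction Φ) :=
  ⟨Φ, hΦ, fun _ _ h => mem_computedFunction.mp h⟩

/-- A pointwise criterion for Weihrauch reducibility. -/
theorem weihrauchReducible_of_oraclePartrec {f g : Problem} {Κ Η : Baire → ℕ →. ℕ}
    (hΚ : OraclePartrec Κ) (hΗ : OraclePartrec Η)
    (h : ∀ p, ∀ x ∈ f.dom, f.inRep.IsName p x → ∃ r : Baire, (∀ n, r n ∈ Κ p n) ∧
      ∃ z ∈ g.dom, g.inRep.IsName r z ∧ ∀ q, ∀ y ∈ g.sol z, g.outRep.IsName q y →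
        ∃ s : Baire, (∀ n, s n ∈ Η (bairePair p q) n) ∧ ∃ y ∈ f.sol x, f.outRep.IsName s y) :
    WeihrauchReducible f g := by
  refine ⟨computedFunction Η, computedFunction Κ, computableOnBaire_computedFunction hΗ,
    computableOnBaire_computedFunction hΚ, fun G hG p x hx hp => ?_⟩
  obtain ⟨r, hr, z, hz, hrz, hsol⟩ := h p x hx hp
  obtain ⟨q, hq, y, hy, hqy⟩ := hG r z hz hrz
  obtain ⟨s, hs, hsx⟩ := hsol q y hy hqy
  refine ⟨s, ?_, hsx⟩
  simp only [Part.mem_bind_iff]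
  exact ⟨r, mem_computedFunction.mpr hr, q, hq, mem_computedFunction.mpr hs⟩

/-! ### Ramsey's theorem -/

/-- The infinite Ramsey theorem, inside a given infinite set. -/
theorem exists_infinite_homogeneous {κ : Type*} [Finite κ] (n : ℕ) (c : Finset ℕ → κ)
    {S : Set ℕ} (hS : S.Infinite) :
    ∃ M ⊆ S, M.Infinite ∧ ∃ a, ∀ A : Finset ℕ, A.card = n → (A : Set ℕ) ⊆ M → c A = a := by
  induction n generalizing c S with
  | zero =>
    exact ⟨S, subset_rfl, hS, c ∅, fun A hA _ => by rw [Finset.card_eq_zero.mp hA]⟩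
  | succ n ih =>
    -- Thinning: choose a point `x` of the reservoir and shrink the rest so that the color of
    -- `insert x A` no longer depends on `A`.
    have step : ∀ R : {R : Set ℕ // R.Infinite}, ∃ R' : {R : Set ℕ // R.Infinite},
        ∃ x ∈ R.1, ∃ b, (∀ y ∈ R'.1, y ∈ R.1 ∧ x < y) ∧
          ∀ A : Finset ℕ, A.card = n → (A : Set ℕ) ⊆ R'.1 → c (insert x A) = b := by
      rintro ⟨R, hR⟩
      obtain ⟨x, hx⟩ := hR.nonempty
      have hR' : (R \ Set.Iic x).Infinite := hR.sdiff (Set.finite_Iic x)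
      obtain ⟨M, hM, hMi, b, hb⟩ := ih (fun A => c (insert x A)) hR'
      exact ⟨⟨M, hMi⟩, x, hx, b, fun y hy => ⟨(hM hy).1, by simpa using (hM hy).2⟩, hb⟩
    choose next x hx b hnext hb using step
    let R : ℕ → {R : Set ℕ // R.Infinite} := fun k => next^[k] ⟨S, hS⟩
    have hRsucc : ∀ k, R (k + 1) = next (R k) := fun k => Function.iterate_succ_apply' _ _ _
    have hanti : ∀ j k, j ≤ k → (R k).1 ⊆ (R j).1 := by
      intro j k hjk
      induction k, hjk using Nat.le_induction with
      | base => exact subset_rfl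
      | succ k _ ihk =>
        rw [hRsucc]
        exact fun y hy => ihk (hnext _ y hy).1
    have hmem : ∀ j k, j < k → x (R k) ∈ (next (R j)).1 := fun j k hjk =>
      hRsucc j ▸ hanti (j + 1) k hjk (hx (R k))
    have hmono : StrictMono fun k => x (R k) := fun j k hjk => (hnext _ _ (hmem j k hjk)).2
    -- The color of a set of chosen points now depends only on its minimum, so one more pigeonhole
    -- suffices.
    obtain ⟨a, ha⟩ := Finite.exists_infinite_fiber fun k => b (R k)
    have ha' : ((fun k => b (R k)) ⁻¹' {a}).Infinite := Set.infinite_coe_iff.mp ha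
    refine ⟨(fun k => x (R k)) '' ((fun k => b (R k)) ⁻¹' {a}), ?_,
      ha'.image hmono.injective.injOn, a, fun A hA hAM => ?_⟩
    · rintro _ ⟨k, _, rfl⟩
      exact hanti 0 k (Nat.zero_le k) (hx _)
    · have hne : A.Nonempty := Finset.card_pos.mp (by omega)
      obtain ⟨k, hk, hkA⟩ := hAM (A.min'_mem hne)
      have hlt : ∀ y ∈ A.erase (A.min' hne), A.min' hne < y := fun y hy =>
        Finset.min'_lt_of_mem_erase_min' A hne hy
      rw [← Finset.insert_erase (A.min'_mem hne), ← hkA]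
      refine (hb (R k) _ ?_ ?_).trans hk
      · rw [hkA, Finset.card_erase_of_mem (A.min'_mem hne), hA]
        rfl
      · intro y hy
        have hy' : y ∈ A.erase (A.min' hne) := by simpa [hkA, and_comm] using hy
        obtain ⟨j, _, rfl⟩ := hAM (Finset.mem_of_mem_erase hy')
        refine hmem k j (hmono.lt_iff_lt.mp ?_)
        simpa only [hkA] using hlt _ hy'

open Classical in
theorem exists_isInfiniteHomogeneous {n k : ℕ} (c : Coloring n k) (hk : 0 < k) :
    ∃ M : Set ℕ, IsInfiniteHomogeneous c M := by
  obtain ⟨M, _, hM, a, ha⟩ := exists_infinite_homogeneous n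
    (fun A => if h : A ∈ Set.powersetCard ℕ n then c ⟨A, h⟩ else ⟨0, hk⟩) Set.infinite_univ
  refine ⟨M, hM, a, fun A hA => ?_⟩
  rw [← ha A.1 A.2 hA, dif_pos A.2]

/-! ### Iterated limits along infinite sets -/

/-- `P [z₁, …, zₘ]` holds for all sufficiently large `z₁`, all `z₂` sufficiently large depending on
`z₁`, and so on. -/
def IterEventually : ℕ → (List ℕ → Prop) → Prop
  | 0, P => P []
  | m + 1, P => ∀ᶠ z in atTop, IterEventually m fun l => P (z :: l)

namespace IterEventually

theorem mono {m : ℕ} {P Q : List ℕ → Prop} (h : IterEventually m P)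
    (hPQ : ∀ l, l.length = m → P l → Q l) : IterEventually m Q := by
  induction m generalizing P Q with
  | zero => exact hPQ [] rfl h
  | succ m ih =>
    exact Eventually.mono h fun z hz => ih hz fun l hl => hPQ (z :: l) (by simp [hl])

theorem and {m : ℕ} {P Q : List ℕ → Prop} (hP : IterEventually m P) (hQ : IterEventually m Q) :
    IterEventually m fun l => P l ∧ Q l := by
  induction m generalizing P Q with
  | zero => exact ⟨hP, hQ⟩
  | succ m ih =>
    have h : ∀ᶠ z in atTop, IterEventually m (fun l => P (z :: l)) ∧
      IterEventually m (fun l => Q (z :: l)) := Eventually.and hP hQ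
    exact h.mono fun z hz => ih hz.1 hz.2

theorem of_forall {m : ℕ} {P : List ℕ → Prop} (h : ∀ l, P l) : IterEventually m P := by
  induction m generalizing P with
  | zero => exact h []
  | succ m ih => exact Eventually.of_forall fun z => ih fun l => h _

theorem forall_lt {m : ℕ} {P : ℕ → List ℕ → Prop} (a : ℕ) (h : ∀ i, IterEventually m (P i)) :
    IterEventually m fun l => ∀ i < a, P i l := by
  induction a with
  | zero => exact of_forall fun l i hi => absurd hi (Nat.not_lt_zero i)
  | succ a ih =>
    refine (ih.and (h a)).mono fun l _ hl i hi => ?_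
    rcases Nat.lt_succ_iff_lt_or_eq.mp hi with h | rfl
    · exact hl.1 i h
    · exact hl.2

/-- The innermost quantifier may be split off. -/
theorem concat {m : ℕ} {P : List ℕ → Prop}
    (h : IterEventually m fun l => ∀ᶠ y in atTop, P (l ++ [y])) : IterEventually (m + 1) P := by
  induction m generalizing P with
  | zero => exact h
  | succ m ih => exact Eventually.mono h fun z hz => ih hz

/-- An iterated limit is attained along every infinite set. -/
theorem exists_sorted {m : ℕ} {P : List ℕ → Prop} (h : IterEventually m P) {M : Set ℕ}
    (hM : M.Infinite) (b : ℕ) :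
    ∃ l : List ℕ, l.length = m ∧ (b :: l).Pairwise (· < ·) ∧ (∀ z ∈ l, z ∈ M) ∧ P l := by
  induction m generalizing P b with
  | zero => exact ⟨[], rfl, by simp, by simp, h⟩
  | succ m ih =>
    obtain ⟨z, hzM, hbz, hz⟩ : ∃ z ∈ M, b < z ∧ IterEventually m fun l => P (z :: l) := by
      obtain ⟨z, hzM, hz⟩ := (Nat.frequently_atTop_iff_infinite.mpr hM).and_eventually
        ((eventually_gt_atTop b).and h) |>.exists
      exact ⟨z, hzM, hz⟩
    obtain ⟨l, hl, hs, hlM, hP⟩ := ih hz z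
    refine ⟨z :: l, by simp [hl], ?_, ?_, hP⟩
    · rw [← List.isChain_iff_pairwise] at hs ⊢
      exact List.IsChain.cons_cons hbz hs
    · simpa using ⟨hzM, hlM⟩

end IterEventually

/-! ### The agreement coloring -/

/-- The color of `{a < z₀ < ⋯ < z_{m+1}}` tells whether `W [z₀, …, zₘ]` and `W [z₁, …, z_{m+1}]`
agree below `a`. -/
def agreeColor (W : List ℕ → Baire) (l : List ℕ) : Fin 2 :=
  if ∀ i < l.headI, W l.tail.dropLast i = W l.tail.tail i then 1 else 0

/-- The coloring of `n`-element sets by `agreeColor`. -/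
def agreeColoring (W : List ℕ → Baire) (n : ℕ) : Coloring n 2 :=
  fun A => agreeColor W A.1.sort

theorem Finset.sort_eq_of_pairwise {A : Finset ℕ} {l : List ℕ} (hl : l.Pairwise (· < ·))
    (h : ∀ x, x ∈ A ↔ x ∈ l) : A.sort = l :=
  (Finset.sortedLT_sort A).eq_of_mem_iff hl.sortedLT fun x => (Finset.mem_sort _).trans (h x)

theorem agreeColoring_toFinset (W : List ℕ → Baire) {n : ℕ} {l : List ℕ}
    (hl : l.Pairwise (· < ·)) (h : l.toFinset ∈ Set.powersetCard ℕ n) :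
    agreeColoring W n ⟨l.toFinset, h⟩ = agreeColor W l := by
  rw [agreeColoring, Finset.sort_eq_of_pairwise hl fun x => List.mem_toFinset]

/-- A large new element `y` enters the color only as the last entry of the second window, and only
the finitely many coordinates below `a` are compared. Convergence of `W` in its last index therefore
fixes the color. -/
theorem isStable_agreeColoring {W : List ℕ → Baire} {m : ℕ}
    (h : ∀ ws : List ℕ, ws.length = m → ∀ i, ∃ v, ∀ᶠ y in atTop, W (ws ++ [y]) i = v) :
    IsStable (agreeColoring W (m + 3)) := by
  intro A hA
  obtain ⟨a, z, ws, hsort⟩ : ∃ (a z : ℕ) (ws : List ℕ), A.sort (· ≤ ·) = a :: z :: ws := by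
    have hlen : A.sort.length = m + 2 := by rw [Finset.length_sort]; omega
    rcases hs : A.sort (· ≤ ·) with _ | ⟨a, _ | ⟨z, ws⟩⟩
    · simp [hs] at hlen
    · simp [hs] at hlen
    · exact ⟨a, z, ws, rfl⟩
  have hws : ws.length = m := by
    have := congrArg List.length hsort
    rw [Finset.length_sort] at this
    simp only [List.length_cons] at this
    omega
  choose v hv using h ws hws
  refine ⟨if ∀ i < a, W (z :: ws) i = v i then 1 else 0, ?_⟩
  have hev : ∀ᶠ y in atTop, ∀ i ∈ Finset.range a, W (ws ++ [y]) i = v i :=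
    (Finset.eventually_all _).mpr fun i _ => hv i
  filter_upwards [hev, eventually_gt_atTop (A.sup id)] with y hy hyA hcard
  have hlt : ∀ x ∈ A, x < y := fun x hx => (Finset.le_sup (f := id) hx).trans_lt hyA
  have hs : (insert y A).sort = a :: z :: ws ++ [y] := by
    rw [← hsort]
    refine Finset.sort_eq_of_pairwise ?_ (by simp [or_comm])
    refine List.pairwise_append.mpr ⟨(Finset.sortedLT_sort A).pairwise, by simp, ?_⟩
    simpa using hlt
  rw [agreeColoring, hs, agreeColor]
  have hdl : (z :: (ws ++ [y])).dropLast = z :: ws := by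
    rw [← List.cons_append, List.dropLast_concat]
  refine if_congr (forall₂_congr fun i hi => ?_) rfl rfl
  rw [← hy i (Finset.mem_range.mpr hi)]
  change W (z :: (ws ++ [y])).dropLast i = _ ↔ _
  rw [hdl]
  rfl

/-- Pigeonhole: an infinite set has an infinite subset on which finitely many finite-valued
functions are constant. -/
theorem exists_infinite_subset_agree {V : ℕ → Baire}
    (hV : ∀ i, (Set.range fun z => V z i).Finite) {M : Set ℕ} (hM : M.Infinite) (a : ℕ) :
    ∃ M' ⊆ M, M'.Infinite ∧ ∀ z ∈ M', ∀ z' ∈ M', ∀ i < a, V z i = V z' i := by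
  induction a with
  | zero => exact ⟨M, subset_rfl, hM, fun _ _ _ _ i hi => absurd hi (Nat.not_lt_zero i)⟩
  | succ a ih =>
    obtain ⟨M', hsub, hinf, hagree⟩ := ih
    obtain ⟨v, hv⟩ : ∃ v, (M' ∩ {z | V z a = v}).Infinite := by
      by_contra! hcon
      refine hinf (((hV a).biUnion fun v _ => hcon v).subset fun z hz => ?_)
      exact Set.mem_biUnion (Set.mem_range_self z) ⟨hz, rfl⟩
    refine ⟨_, Set.inter_subset_left.trans hsub, hv, fun z hz z' hz' i hi => ?_⟩
    rcases Nat.lt_succ_iff_lt_or_eq.mp hi with h | rfl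
    · exact hagree z hz.1 z' hz'.1 i h
    · exact hz.2.trans hz'.2.symm

/-! ### Homogeneous sets of the agreement coloring -/

section Homogeneous

variable {m : ℕ} {W : List ℕ → Baire} {V : ℕ → Baire} {M : Set ℕ}

/-- If `W (z :: ·)` converges to `V z` in the sense of iterated limits and `V` is pointwise
finite-valued, then homogeneous sets of the agreement coloring have the color of agreement. -/
theorem agree_of_homogeneous
    (hW : ∀ z i, IterEventually m fun ys => W (z :: ys) i = V z i)
    (hV : ∀ i, (Set.range fun z => V z i).Finite)
    (hM : IsInfiniteHomogeneous (agreeColoring W (m + 3)) M) {a : ℕ} {zs : List ℕ}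
    (hlen : zs.length = m + 2) (hsort : (a :: zs).Pairwise (· < ·)) (hmem : ∀ z ∈ a :: zs, z ∈ M)
    {i : ℕ} (hi : i < a) : W zs.dropLast i = W zs.tail i := by
  obtain ⟨hinf, b, hb⟩ := hM
  have hcol : ∀ l : List ℕ, l.length = m + 3 → l.Pairwise (· < ·) → (∀ z ∈ l, z ∈ M) →
      agreeColor W l = b := by
    intro l hl hs hlM
    have hcard : l.toFinset ∈ Set.powersetCard ℕ (m + 3) := by
      rw [Set.powersetCard.mem_iff, List.toFinset_card_of_nodup hs.sortedLT.nodup, hl]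
    rw [← hb ⟨_, hcard⟩ fun z hz => hlM z (by simpa using hz), agreeColoring_toFinset W hs]
  -- It suffices to exhibit one subset of `M` with the color of agreement.
  have hb1 : b = 1 := by
    obtain ⟨c, hcM⟩ := hinf.nonempty
    obtain ⟨M', hM', hinf', hagree⟩ := exists_infinite_subset_agree hV hinf c
    obtain ⟨z₀, hz₀, hcz₀⟩ := hinf'.exists_gt c
    -- The last element belongs to the second window only, so it is unconstrained here. Quantifying
    -- over it as well lets this condition be met together with the one for the window starting at
    -- `z₁`.
    have h₀ : IterEventually (m + 1) fun l => ∀ i < c, W (z₀ :: l.dropLast) i = V z₀ i :=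
      IterEventually.concat <| (IterEventually.forall_lt c (hW z₀)).mono fun l _ hl =>
        Eventually.of_forall fun y => by simpa using hl
    obtain ⟨z₁, hz₁, hlt, h₁⟩ := ((Nat.frequently_atTop_iff_infinite.mpr hinf').and_eventually
      ((eventually_gt_atTop z₀).and h₀)).exists
    obtain ⟨ys, hys, hsorted, hysM, hP, hQ⟩ :=
      (h₁.and (IterEventually.forall_lt c (hW z₁))).exists_sorted hinf z₁
    rw [← hcol (c :: z₀ :: z₁ :: ys) (by simp [hys]) ?_ ?_]
    · refine if_pos fun i hi => ?_
      simp only [List.headI_cons] at hi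
      simp only [List.tail_cons, List.dropLast_cons_cons] at hP ⊢
      rw [hP i hi, hQ i hi]
      exact hagree _ hz₀ _ hz₁ i hi
    · rw [← List.isChain_iff_pairwise] at hsorted ⊢
      exact .cons_cons hcz₀ (.cons_cons hlt hsorted)
    · simpa using ⟨hcM, hM' hz₀, hM' hz₁, hysM⟩
  have := hcol (a :: zs) (by simp [hlen]) hsort hmem
  rw [hb1, agreeColor] at this
  by_contra hne
  rw [if_neg] at this
  · exact absurd this (by decide)
  · exact fun h => hne (h i hi)

/-- Iterates agreement of neighboring windows. The element `a` need not be adjacent to the windows,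
so it can stay fixed while they slide. -/
theorem eq_window_of_homogeneous
    (hW : ∀ z i, IterEventually m fun ys => W (z :: ys) i = V z i)
    (hV : ∀ i, (Set.range fun z => V z i).Finite)
    (hM : IsInfiniteHomogeneous (agreeColoring W (m + 3)) M) {a : ℕ} {L : List ℕ}
    (hsort : (a :: L).Pairwise (· < ·)) (hmem : ∀ z ∈ a :: L, z ∈ M) {i : ℕ} (hi : i < a) (j : ℕ)
    (hlen : m + 1 + j ≤ L.length) : W (L.take (m + 1)) i = W ((L.drop j).take (m + 1)) i := by
  induction j with
  | zero => rfl
  | succ j ih =>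
    rw [ih (by omega)]
    have hsub : (a :: (L.drop j).take (m + 2)).Sublist (a :: L) :=
      ((List.take_sublist _ _).trans (List.drop_sublist _ _)).cons_cons a
    have hl : ((L.drop j).take (m + 2)).length = m + 2 := by
      simp only [List.length_take, List.length_drop]
      omega
    have := agree_of_homogeneous hW hV hM hl (hsort.sublist hsub)
      (fun z hz => hmem z (hsub.subset hz)) hi
    have h1 : ((L.drop j).take (m + 2)).dropLast = (L.drop j).take (m + 1) := by
      rw [List.dropLast_eq_take, hl, List.take_take]
      simp
    have h2 : ((L.drop j).take (m + 2)).tail = (L.drop (j + 1)).take (m + 1) := by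
      rw [← List.drop_one, List.drop_take, List.drop_drop]
      rfl
    rw [← h1, this, h2]

/-- Along a homogeneous set `M` of the agreement coloring, `V` converges to a point that can be
read off from `W` and `M`. -/
theorem exists_limit_of_homogeneous
    (hW : ∀ z i, IterEventually m fun ys => W (z :: ys) i = V z i)
    (hV : ∀ i, (Set.range fun z => V z i).Finite)
    (hM : IsInfiniteHomogeneous (agreeColoring W (m + 3)) M) :
    ∃ x : Baire, (∀ i a zs, i < a → zs.length = m + 1 → (a :: zs).Pairwise (· < ·) →
        (∀ z ∈ a :: zs, z ∈ M) → W zs i = x i) ∧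
      ∀ i, ∀ᶠ z in atTop, z ∈ M → V z i = x i := by
  have hbeyond : ∀ b, ∃ ws : List ℕ, ws.length = m + 1 ∧ (b :: ws).Pairwise (· < ·) ∧
      ∀ z ∈ ws, z ∈ M := fun b => by
    obtain ⟨ws, h1, h2, h3, -⟩ := (IterEventually.of_forall (m := m + 1)
      (P := fun _ => True) fun _ => trivial).exists_sorted hM.1 b
    exact ⟨ws, h1, h2, h3⟩
  -- Slide by `m + 1` places along `zs ++ ws`, from its first half to its second.
  have hshift : ∀ (i a : ℕ) (zs ws : List ℕ), i < a → zs.length = m + 1 → ws.length = m + 1 →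
      (a :: zs).Pairwise (· < ·) → ws.Pairwise (· < ·) → (∀ z ∈ a :: zs, z ∈ M) →
      (∀ z ∈ ws, z ∈ M) → (∀ z ∈ a :: zs, ∀ w ∈ ws, z < w) → W zs i = W ws i := by
    intro i a zs ws hi hzs hws hsz hsw hzM hwM hlt
    have hs : (a :: (zs ++ ws)).Pairwise (· < ·) := by
      rw [← List.cons_append]
      exact List.pairwise_append.mpr ⟨hsz, hsw, hlt⟩
    have hmem : ∀ z ∈ a :: (zs ++ ws), z ∈ M := by
      intro z hz
      rw [← List.cons_append] at hz
      exact (List.mem_append.mp hz).elim (hzM z) (hwM z)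
    have := eq_window_of_homogeneous hW hV hM hs hmem hi (m + 1) (by simp [hzs, hws])
    rwa [List.take_left' hzs, List.drop_left' hzs, ← hws, List.take_length] at this
  -- Two windows may interleave; both are compared with a third one beyond them.
  have hconst : ∀ (i a a' : ℕ) (zs zs' : List ℕ), i < a → i < a' → zs.length = m + 1 →
      zs'.length = m + 1 → (a :: zs).Pairwise (· < ·) → (a' :: zs').Pairwise (· < ·) →
      (∀ z ∈ a :: zs, z ∈ M) → (∀ z ∈ a' :: zs', z ∈ M) → W zs i = W zs' i := by
    intro i a a' zs zs' hi hi' hzs hzs' hsz hsz' hzM hzM'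
    obtain ⟨b, hb⟩ := ((a :: zs) ++ (a' :: zs')).toFinset.exists_le
    obtain ⟨ws, hws, hsw, hwM⟩ := hbeyond b
    rw [List.pairwise_cons] at hsw
    rw [hshift i a zs ws hi hzs hws hsz hsw.2 hzM hwM, hshift i a' zs' ws hi' hzs' hws hsz' hsw.2
      hzM' hwM]
    · exact fun z hz w hw => (hb z (List.mem_toFinset.mpr
        (List.mem_append.mpr (.inr hz)))).trans_lt (hsw.1 w hw)
    · exact fun z hz w hw => (hb z (List.mem_toFinset.mpr
        (List.mem_append.mpr (.inl hz)))).trans_lt (hsw.1 w hw)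
  choose a haM hia using fun i : ℕ => hM.1.exists_gt i
  choose zs hzs hsort hzM using fun i => hbeyond (a i)
  have hzM' : ∀ i, ∀ z ∈ a i :: zs i, z ∈ M := fun i => by simpa using ⟨haM i, hzM i⟩
  refine ⟨fun i => W (zs i) i, fun i a' zs' hi hlen hs hmem =>
    hconst i _ _ _ _ hi (hia i) hlen (hzs i) hs (hsort i) hmem (hzM' i), fun i => ?_⟩
  filter_upwards [eventually_gt_atTop (a i)] with z hz hzMem
  obtain ⟨ys, hys, hs, hysM, hval⟩ := (hW z i).exists_sorted hM.1 z
  -- The value `V z i` is attained on a window in `M` starting at `z`, and `a i` precedes that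
  -- window.
  rw [← hval]
  refine hconst i (a i) _ _ _ (hia i) (hia i) (by simp [hys]) (hzs i) ?_ (hsort i) ?_ (hzM' i)
  · rw [← List.isChain_iff_pairwise] at hs ⊢
    exact .cons_cons hz hs
  · simpa using ⟨haM i, hzMem, hysM⟩

end Homogeneous

/-! ### Computing the agreement coloring and its limits -/

/-- The increasing enumeration of `subsetNumbering n e`. -/
def subsetList : ℕ → ℕ → List ℕ
  | 0, _ => []
  | 1, i => [i]
  | n + 2, e => e.unpair.1 :: (subsetList (n + 1) e.unpair.2).map (· + (e.unpair.1 + 1))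

theorem mem_subsetList : ∀ n e x, x ∈ subsetNumbering n e ↔ x ∈ subsetList n e
  | 0, _, x => by simp [subsetNumbering, subsetList]
  | 1, _, x => by simp [subsetNumbering, subsetList]
  | n + 2, e, x => by
    simp [subsetNumbering, subsetList, mem_subsetList (n + 1)]

theorem pairwise_subsetList : ∀ n e, (subsetList n e).Pairwise (· < ·)
  | 0, _ => by simp [subsetList]
  | 1, _ => by simp [subsetList]
  | n + 2, e => by
    rw [subsetList, List.pairwise_cons]
    refine ⟨fun x hx => ?_, ?_⟩
    · obtain ⟨y, _, rfl⟩ := List.mem_map.mp hx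
      omega
    · exact (pairwise_subsetList (n + 1) _).map _ fun a b h => by omega

theorem primrec_subsetList : ∀ n, Primrec (subsetList n)
  | 0 => Primrec.const []
  | 1 => Primrec.list_cons.comp Primrec.id (Primrec.const [])
  | n + 2 => by
    have h1 : Primrec fun e : ℕ => e.unpair.1 := Primrec.fst.comp Primrec.unpair
    have h2 : Primrec fun e : ℕ => e.unpair.2 := Primrec.snd.comp Primrec.unpair
    exact Primrec.list_cons.comp h1 (Primrec.list_map ((primrec_subsetList (n + 1)).comp h2)
      (Primrec.nat_add.comp Primrec.snd (Primrec.succ.comp (h1.comp Primrec.fst))))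

theorem agreeColoring_theta (W : List ℕ → Baire) (n e : ℕ) :
    agreeColoring W n (theta n e) = agreeColor W (subsetList n e) := by
  rw [agreeColoring, theta, Finset.sort_eq_of_pairwise (pairwise_subsetList n e)
    (mem_subsetList n e)]

theorem Primrec.list_dropLast {α : Type*} [Primcodable α] : Primrec (@List.dropLast α) :=
  (Primrec.list_take.comp (Primrec.nat_sub.comp Primrec.list_length (Primrec.const 1))
    Primrec.id).of_eq fun _ => List.dropLast_eq_take.symm

/-- Bounded universal quantifiers, with parameters of any type, are primitive recursive. -/
theorem PrimrecRel.forall_nat_lt {β : Type*} [Primcodable β] {R : ℕ → β → Prop}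
    (hR : PrimrecRel R) : PrimrecRel fun n y => ∀ x < n, R x y :=
  (hR.forall_mem_list.comp (Primrec.list_range.comp Primrec.fst) Primrec.snd).of_eq (by simp)

/-- A family of points of Baire space that is indexed by lists, as a single point. -/
def baireOfFamily (W : List ℕ → Baire) : Baire :=
  fun n => W (Denumerable.ofNat (List ℕ) n.unpair.1) n.unpair.2

/-- The position of `W zs i` in `baireOfFamily W`. -/
def familyIndex (zs : List ℕ) (i : ℕ) : ℕ := Nat.pair (Encodable.encode zs) i

theorem baireOfFamily_familyIndex (W : List ℕ → Baire) (zs : List ℕ) (i : ℕ) :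
    baireOfFamily W (familyIndex zs i) = W zs i := by
  simp [baireOfFamily, familyIndex]

theorem primrec_familyIndex : Primrec₂ familyIndex :=
  Primrec₂.natPair.comp (Primrec.encode.comp Primrec.fst) Primrec.snd

/-- The color compares `W` at finitely many places that are computable from the code of the set. -/
theorem exists_oraclePartrec_agreeColor (n : ℕ) :
    ∃ Φ, OraclePartrec Φ ∧ ∀ (W : List ℕ → Baire) (e : ℕ),
      (agreeColor W (subsetList n e) : ℕ) ∈ Φ (baireOfFamily W) e := by
  have hs := primrec_subsetList n
  have ha : Primrec fun e => (subsetList n e).headI := Primrec.list_headI.comp hs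
  have hleft : Primrec₂ fun (i e : ℕ) => familyIndex (subsetList n e).tail.dropLast i :=
    primrec_familyIndex.comp
      (Primrec.list_dropLast.comp (Primrec.list_tail.comp (hs.comp Primrec.snd))) Primrec.fst
  have hright : Primrec₂ fun (i e : ℕ) => familyIndex (subsetList n e).tail.tail i :=
    primrec_familyIndex.comp
      (Primrec.list_tail.comp (Primrec.list_tail.comp (hs.comp Primrec.snd))) Primrec.fst
  let Q : ℕ → List ℕ := fun e => (List.range (subsetList n e).headI).flatMap fun i =>
    [familyIndex (subsetList n e).tail.dropLast i, familyIndex (subsetList n e).tail.tail i]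
  have hQ : Primrec Q := Primrec.list_flatMap (Primrec.list_range.comp ha)
    (Primrec.list_cons.comp (hleft.comp Primrec.snd Primrec.fst)
      (Primrec.list_cons.comp (hright.comp Primrec.snd Primrec.fst) (Primrec.const [])))
  have hrel : PrimrecRel fun (i : ℕ) (x : ℕ × List ℕ) =>
      x.2[familyIndex (subsetList n x.1).tail.dropLast i]? =
        x.2[familyIndex (subsetList n x.1).tail.tail i]? :=
    Primrec.eq.comp
      (Primrec.list_getElem?.comp (Primrec.snd.comp Primrec.snd)
        (hleft.comp Primrec.fst (Primrec.fst.comp Primrec.snd)))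
      (Primrec.list_getElem?.comp (Primrec.snd.comp Primrec.snd)
        (hright.comp Primrec.fst (Primrec.fst.comp Primrec.snd)))
  have hall : PrimrecPred fun x : ℕ × List ℕ => ∀ i < (subsetList n x.1).headI,
      x.2[familyIndex (subsetList n x.1).tail.dropLast i]? =
        x.2[familyIndex (subsetList n x.1).tail.tail i]? := by
    have := hrel.forall_nat_lt
    exact this.comp (ha.comp Primrec.fst) Primrec.id
  have hf : Primrec₂ fun (e : ℕ) (l : List ℕ) => if ∀ i < (subsetList n e).headI,
      l[familyIndex (subsetList n e).tail.dropLast i]? =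
        l[familyIndex (subsetList n e).tail.tail i]? then 1 else 0 :=
    Primrec.ite hall (Primrec.const 1) (Primrec.const 0)
  obtain ⟨Φ, hΦ, h⟩ := OraclePartrec.of_queries hQ hf (F := fun w e =>
    if ∀ i < (subsetList n e).headI, w (familyIndex (subsetList n e).tail.dropLast i) =
      w (familyIndex (subsetList n e).tail.tail i) then 1 else 0) (by
    intro p e l hl
    refine if_congr (forall₂_congr fun i hi => ?_) rfl rfl
    rw [hl, hl, Option.some_inj]
    · exact List.mem_flatMap.mpr ⟨i, List.mem_range.mpr hi, by simp⟩
    · exact List.mem_flatMap.mpr ⟨i, List.mem_range.mpr hi, by simp⟩)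
  refine ⟨Φ, hΦ, fun W e => ?_⟩
  convert h (baireOfFamily W) e using 1
  simp only [baireOfFamily_familyIndex, agreeColor]
  split_ifs <;> rfl

/-- The elements above `i` of the set coded in the second component of a pair, as far as an initial
segment of the pair decides membership. -/
def knownMembers (i : ℕ) (l : List ℕ) : List ℕ :=
  (List.range (l.length / 2)).filter fun j => i < j ∧ l[2 * j + 1]? = some 1

theorem primrec_knownMembers : Primrec₂ knownMembers := by
  have hrel : PrimrecRel fun (j : ℕ) (x : ℕ × List ℕ) => x.1 < j ∧ x.2[2 * j + 1]? = some 1 :=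
    PrimrecPred.and (Primrec.nat_lt.comp (Primrec.fst.comp Primrec.snd) Primrec.fst)
      (Primrec.eq.comp (Primrec.list_getElem?.comp (Primrec.snd.comp Primrec.snd)
        (Primrec.succ.comp (Primrec.nat_mul.comp (Primrec.const 2) Primrec.fst)))
        (Primrec.const (some 1)))
  exact hrel.listFilter.comp (Primrec.list_range.comp
    (Primrec.nat_div.comp (Primrec.list_length.comp Primrec.snd) (Primrec.const 2))) Primrec.id

theorem knownMembers_bairePair (i N : ℕ) (w q : Baire) :
    knownMembers i ((List.range N).map (bairePair w q)) =
      (List.range (N / 2)).filter fun j => i < j ∧ q j = 1 := by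
  rw [knownMembers, List.length_map, List.length_range]
  refine List.filter_congr fun j hj => ?_
  have hj' : 2 * j + 1 < N := by
    have := List.mem_range.mp hj
    omega
  have h1 : (2 * j + 1) % 2 = 1 := by omega
  have h2 : (2 * j + 1) / 2 = j := by omega
  simp [hj', bairePair, h1, h2]

/-- Search for `m + 2` members of the set above `i`: the first serves as `a`, the others form the
window. All such choices give the value `x i`, so it does not matter when the search stops. -/
theorem exists_oraclePartrec_limit (m : ℕ) :
    ∃ Φ, OraclePartrec Φ ∧ ∀ (W : List ℕ → Baire) (q x : Baire) (y : ℕ → Bool),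
      cantorRep.IsName q y → {i | y i = true}.Infinite →
      (∀ i a zs, i < a → zs.length = m + 1 → (a :: zs).Pairwise (· < ·) →
        (∀ z ∈ a :: zs, y z = true) → W zs i = x i) →
      ∀ i, x i ∈ Φ (bairePair (baireOfFamily W) q) i := by
  -- The factor `2` below appears because `W` occupies the even places of the pair.
  have hg : Primrec₂ fun (i : ℕ) (l : List ℕ) => if m + 2 ≤ (knownMembers i l).length then
      l[2 * familyIndex ((knownMembers i l).tail.take (m + 1)) i]? else none :=
    Primrec.ite (Primrec.nat_le.comp (Primrec.const (m + 2))
        (Primrec.list_length.comp primrec_knownMembers))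
      (Primrec.list_getElem?.comp Primrec.snd (Primrec.nat_mul.comp (Primrec.const 2)
        (primrec_familyIndex.comp (Primrec.list_take.comp (Primrec.const (m + 1))
          (Primrec.list_tail.comp primrec_knownMembers)) Primrec.fst)))
      (Primrec.const none)
  obtain ⟨Φ, hΦ, h⟩ := OraclePartrec.search hg
  refine ⟨Φ, hΦ, fun W q x y hq hinf hx i => h _ i _ ?_ ?_⟩
  · obtain ⟨L, hL, hs, hLy, -⟩ := (IterEventually.of_forall (m := m + 2)
      (P := fun _ => True) fun _ => trivial).exists_sorted hinf i
    obtain ⟨b, hb⟩ := L.toFinset.exists_nat_subset_range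
    rw [List.pairwise_cons] at hs
    let K : ℕ → List ℕ := fun N => (List.range N).filter fun j => i < j ∧ q j = 1
    have hK : ∀ N, b ≤ N → m + 2 ≤ (K N).length := by
      intro N hN
      rw [← hL]
      refine (List.subperm_of_subset hs.2.sortedLT.nodup fun z hz => ?_).length_le
      have hzb := hb (List.mem_toFinset.mpr hz)
      have hzy : y z = true := hLy z hz
      refine List.mem_filter.mpr ⟨List.mem_range.mpr ?_, ?_⟩
      · exact (Finset.mem_range.mp hzb).trans_le hN
      · simp [hs.1 z hz, hq z, hzy]
    set k := 2 * familyIndex ((K b).tail.take (m + 1)) i with hk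
    -- Long enough both to reveal the members below `b` and to contain place `k`. Members found
    -- later are appended, so the window, and with it `k`, does not change.
    refine ⟨2 * (b + k + 1), ?_⟩
    have hdiv : 2 * (b + k + 1) / 2 = b + (k + 1) := by omega
    have htake : (K (b + (k + 1))).tail.take (m + 1) = (K b).tail.take (m + 1) := by
      have hpre : K b <+: K (b + (k + 1)) := by
        refine List.IsPrefix.filter _ ?_
        rw [List.range_add]
        exact List.prefix_append _ _
      obtain ⟨R, hR⟩ := hpre
      have hlen := hK b le_rfl
      rw [← hR, List.tail_append_of_ne_nil, List.take_append_of_le_length]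
      · rw [List.length_tail]
        omega
      · rintro h0
        simp [h0] at hlen
    rw [knownMembers_bairePair, hdiv]
    change (if m + 2 ≤ (K (b + (k + 1))).length then _ else none).isSome = true
    rw [if_pos (hK _ (by omega))]
    change (_[2 * familyIndex ((K (b + (k + 1))).tail.take (m + 1)) i]?).isSome = true
    rw [htake, ← hk]
    simp
    omega
  · intro N v hv
    rw [knownMembers_bairePair] at hv
    set K := (List.range (N / 2)).filter fun j => i < j ∧ q j = 1 with hK
    have hsorted : K.Pairwise (· < ·) := List.pairwise_lt_range.filter _
    have hmem : ∀ z ∈ K, i < z ∧ y z = true := by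
      intro z hz
      have := (List.mem_filter.mp hz).2
      simp only [hq z, decide_eq_true_eq] at this
      exact ⟨this.1, by simpa using this.2⟩
    split_ifs at hv with hlen
    obtain ⟨a, rest, hKa⟩ : ∃ a rest, K = a :: rest :=
      List.exists_cons_of_length_pos (by omega)
    rw [hKa] at hv hsorted hmem hlen
    simp only [List.tail_cons] at hv
    have hsub : (a :: rest.take (m + 1)).Sublist (a :: rest) :=
      (List.take_sublist _ _).cons_cons a
    rw [← hx i a (rest.take (m + 1)) (hmem a (by simp)).1 ?_ (hsorted.sublist hsub)
      fun z hz => (hmem z (hsub.subset hz)).2]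
    · have h1 : ∀ k, 2 * k % 2 = 0 := fun k => by omega
      have h2 : ∀ k, 2 * k / 2 = k := fun k => by omega
      rw [List.getElem?_map, Option.map_eq_some_iff] at hv
      obtain ⟨n, hn, rfl⟩ := hv
      obtain ⟨_, hn⟩ := List.getElem?_eq_some_iff.mp hn
      rw [List.getElem_range] at hn
      rw [← hn, bairePair, if_pos (h1 _), h2, baireOfFamily_familyIndex]
    · simp only [List.length_cons] at hlen
      simp only [List.length_take]
      omega

/-- A problem whose solutions can be found as limits of subsequences of iterated limits reduces to
Ramsey's theorem. -/
theorem weihrauchReducible_of_iterated_limit {f g : Problem} (m : ℕ) {W : Baire → List ℕ → Baire}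
    (hW : ∃ Φ, OraclePartrec Φ ∧ ∀ p n, baireOfFamily (W p) n ∈ Φ p n)
    (hlim : ∀ p, ∀ x ∈ f.dom, f.inRep.IsName p x → ∃ V : ℕ → Baire,
      (∀ z i, IterEventually m fun ys => W p (z :: ys) i = V z i) ∧
      (∀ i, (Set.range fun z => V z i).Finite) ∧
      ∀ (M : Set ℕ) (s : Baire), M.Infinite → (∀ i, ∀ᶠ z in atTop, z ∈ M → V z i = s i) →
        ∃ y ∈ f.sol x, f.outRep.IsName s y)
    (hg : g = RT (m + 3) 2 ∨ g = SRT (m + 3) 2 ∧ ∀ p, ∀ x ∈ f.dom, f.inRep.IsName p x →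
      ∀ ws : List ℕ, ws.length = m → ∀ i, ∃ v, ∀ᶠ y in atTop, W p (ws ++ [y]) i = v) :
    WeihrauchReducible f g := by
  obtain ⟨Φ, hΦ, hΦW⟩ := hW
  obtain ⟨Κ₀, hΚ₀, hcol⟩ := exists_oraclePartrec_agreeColor (m + 3)
  obtain ⟨Κ, hΚ, hΚsub⟩ := hΚ₀.substitute hΦ
  obtain ⟨Η₀, hΗ₀, hout⟩ := exists_oraclePartrec_limit m
  obtain ⟨Θ, hΘ, hpair⟩ := hΦ.map_bairePair_left
  obtain ⟨Η, hΗ, hΗsub⟩ := hΗ₀.substitute hΘ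
  have hΚmem : ∀ p e, (agreeColoring (W p) (m + 3) (theta (m + 3) e) : ℕ) ∈ Κ p e := by
    intro p e
    rw [hΚsub p _ (hΦW p), agreeColoring_theta]
    exact hcol (W p) e
  have hback : ∀ p, ∀ x ∈ f.dom, f.inRep.IsName p x → ∀ (q : Baire) (y : ℕ → Bool),
      IsInfiniteHomogeneous (agreeColoring (W p) (m + 3)) {i | y i = true} →
      cantorRep.IsName q y → ∃ s : Baire, (∀ n, s n ∈ Η (bairePair p q) n) ∧
        ∃ y ∈ f.sol x, f.outRep.IsName s y := by
    intro p x hx hp q y hy hq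
    obtain ⟨V, hWV, hV, hsol⟩ := hlim p x hx hp
    obtain ⟨s, hs, hVs⟩ := exists_limit_of_homogeneous hWV hV hy
    refine ⟨s, ?_, hsol _ s hy.1 hVs⟩
    rw [hΗsub _ _ (hpair p _ q (hΦW p))]
    exact hout (W p) q s y hq hy.1 hs
  have hdom : ∀ p, ∃ y : ℕ → Bool,
      IsInfiniteHomogeneous (agreeColoring (W p) (m + 3)) {i | y i = true} := by
    intro p
    classical
    obtain ⟨M, hM⟩ := exists_isInfiniteHomogeneous (agreeColoring (W p) (m + 3)) two_pos
    exact ⟨fun i => decide (i ∈ M), by simpa using hM⟩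
  refine weihrauchReducible_of_oraclePartrec hΚ hΗ fun p x hx hp => ⟨_, hΚmem p, ?_⟩
  obtain ⟨y, hy⟩ := hdom p
  rcases hg with rfl | ⟨rfl, hst⟩
  · exact ⟨agreeColoring (W p) (m + 3), ⟨y, hy⟩, fun _ => rfl,
      fun q y hy hq => hback p x hx hp q y hy hq⟩
  · exact ⟨agreeColoring (W p) (m + 3), ⟨y, isStable_agreeColoring (hst p x hx hp), hy⟩,
      fun _ => rfl, fun q y hy hq => hback p x hx hp q y hy.2 hq⟩

/-! ### Iterated limits of names -/

/-- The position of the `k`-th entry of the row `z₀` of the row `z₁` of … of the row `zₘ`, for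
`zs = [z₀, …, zₘ]`. -/
def rowIndex (zs : List ℕ) (k : ℕ) : ℕ := zs.foldl (fun acc z => Nat.pair z acc) k

theorem rowIndex_concat (zs : List ℕ) (y k : ℕ) :
    rowIndex (zs ++ [y]) k = Nat.pair y (rowIndex zs k) := by
  simp [rowIndex, List.foldl_append]

theorem primrec_rowIndex : Primrec₂ rowIndex := by
  have h : Primrec₂ fun (_ : List ℕ × ℕ) (x : ℕ × ℕ) => Nat.pair x.2 x.1 :=
    Primrec₂.natPair.comp (Primrec.snd.comp Primrec.snd) (Primrec.fst.comp Primrec.snd)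
  exact Primrec.list_foldl Primrec.fst Primrec.snd h

theorem tendsto_baireRow_iff {p q : Baire} :
    Tendsto (baireRow p) atTop (𝓝 q) ↔ ∀ k, ∀ᶠ z in atTop, p (Nat.pair z k) = q k := by
  rw [tendsto_pi_nhds]
  refine forall_congr' fun k => ?_
  rw [nhds_discrete, tendsto_pure]
  rfl

/-- The outermost jump is the limit in the last index, whose quantifier is the innermost.
Controlling all places below `b` at once makes the approximation usable by procedures with finitely
many queries. -/
theorem NamingSystem.isName_iterate_jump {X : Type} {δ : NamingSystem X} {m : ℕ} {p : Baire}
    {x : X} (h : (NamingSystem.jump^[m] δ).IsName p x) :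
    ∃ r, δ.IsName r x ∧ ∀ b, IterEventually m fun zs => ∀ k < b, p (rowIndex zs k) = r k := by
  induction m generalizing p with
  | zero => exact ⟨p, h, fun b k _ => rfl⟩
  | succ m ih =>
    rw [Function.iterate_succ_apply'] at h
    obtain ⟨p', hp', hx⟩ := h
    obtain ⟨r, hr, hlim⟩ := ih hx
    refine ⟨r, hr, fun b => IterEventually.concat <| (hlim b).mono fun zs _ hzs => ?_⟩
    have hev : ∀ᶠ y in atTop, ∀ k ∈ Finset.range b,
        p (Nat.pair y (rowIndex zs k)) = p' (rowIndex zs k) :=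
      (Finset.eventually_all _).mpr fun k _ => tendsto_baireRow_iff.mp hp' _
    filter_upwards [hev] with y hy k hk
    rw [rowIndex_concat, hy k (Finset.mem_range.mpr hk), hzs k hk]

theorem Problem.iterJump_eq (f : Problem) (n : ℕ) :
    f.iterJump n = ⟨f.X, f.Y, NamingSystem.jump^[n] f.inRep, f.outRep, f.sol⟩ := by
  induction n generalizing f with
  | zero => rfl
  | succ n ih => exact ih f.jump

/-! ### The limit problem -/

theorem primrec_familyList : Primrec fun n : ℕ => Denumerable.ofNat (List ℕ) n.unpair.1 :=
  (Primrec.ofNat _).comp (Primrec.fst.comp Primrec.unpair)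

/-- The case `m = 0`, where `V z` is the `z`-th row itself. Convergence of the rows yields both the
finiteness of each coordinate's range and stability. -/
theorem lim_le_SRT : WeihrauchReducible limProblem (SRT 3 2) := by
  have hidx : Primrec fun n : ℕ => rowIndex (Denumerable.ofNat (List ℕ) n.unpair.1) n.unpair.2 :=
    primrec_rowIndex.comp primrec_familyList (Primrec.snd.comp Primrec.unpair)
  refine weihrauchReducible_of_iterated_limit 0 (W := fun p zs i => p (rowIndex zs i)) ?_ ?_
    (.inr ⟨rfl, ?_⟩)
  · refine OraclePartrec.of_queries
      (Q := fun n => [rowIndex (Denumerable.ofNat (List ℕ) n.unpair.1) n.unpair.2])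
      (f := fun n l => (l[rowIndex (Denumerable.ofNat (List ℕ) n.unpair.1) n.unpair.2]?).getD 0)
      (F := fun p => baireOfFamily fun zs i => p (rowIndex zs i))
      (Primrec.list_cons.comp hidx (Primrec.const []))
      (Primrec.option_getD.comp (Primrec.list_getElem?.comp Primrec.snd (hidx.comp Primrec.fst))
        (Primrec.const 0)) fun p n l hl => ?_
    rw [hl _ (List.mem_singleton_self _)]
    rfl
  · rintro p x ⟨q, hq⟩ rfl
    have hq' := tendsto_baireRow_iff.mp hq
    refine ⟨fun z i => p (Nat.pair z i), fun z i => rfl, fun i => ?_, fun M s hM hs => ?_⟩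
    · obtain ⟨N, hN⟩ := eventually_atTop.mp (hq' i)
      refine (((Set.finite_Iio N).image fun z => p (Nat.pair z i)).insert (q i)).subset ?_
      rintro _ ⟨z, rfl⟩
      rcases lt_or_ge z N with h | h
      · exact .inr ⟨z, h, rfl⟩
      · exact .inl (hN z h)
    · refine ⟨q, hq, funext fun i => ?_⟩
      obtain ⟨z, hz, h1, h2⟩ := ((Nat.frequently_atTop_iff_infinite.mpr hM).and_eventually
        ((hs i).and (hq' i))).exists
      exact (h1 hz).symm.trans h2
  · rintro p x ⟨q, hq⟩ rfl ws hws i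
    rw [List.length_eq_zero_iff] at hws
    subst hws
    exact ⟨q i, tendsto_baireRow_iff.mp hq i⟩

/-! ### Weak Kőnig's lemma -/

/-- A numbering of binary words, with repetitions of the empty word. -/
def wordOf (c : ℕ) : List Bool := (Encodable.decode (α := List Bool) c).getD []

theorem wordOf_encode (w : List Bool) : wordOf (Encodable.encode w) = w := by
  simp [wordOf]

/-- `c` is the canonical number of a word all of whose prefixes are accepted by `t`. -/
def IsBranch (t : Baire) (c : ℕ) : Prop :=
  Encodable.encode (wordOf c) = c ∧
    ∀ j < (wordOf c).length + 1, t (wordCode ((wordOf c).take j)) = 1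

instance (t : Baire) : DecidablePred (IsBranch t) := fun _ => instDecidableAnd

/-- The branch with the greatest number up to `s`. -/
def bestBranch (t : Baire) (s : ℕ) : ℕ := Nat.findGreatest (IsBranch t) s

/-- The `i`-th bit of the branch with the greatest number up to `s`, padded by zeros. -/
def branchBit (t : Baire) (s i : ℕ) : ℕ := ((wordOf (bestBranch t s)).getD i false).toNat

theorem Nat.findGreatest_congr {P Q : ℕ → Prop} [DecidablePred P] [DecidablePred Q] {n : ℕ}
    (h : ∀ k ≤ n, (P k ↔ Q k)) : Nat.findGreatest P n = Nat.findGreatest Q n := by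
  induction n with
  | zero => rfl
  | succ n ih =>
    rw [Nat.findGreatest_succ, Nat.findGreatest_succ, ih fun k hk => h k (by omega)]
    exact if_congr (h (n + 1) le_rfl) rfl rfl

/-- The places at which `bestBranch t s` inspects `t`. -/
def branchQueries (s : ℕ) : List ℕ :=
  (List.range (s + 1)).flatMap fun c =>
    (List.range ((wordOf c).length + 1)).map fun j => wordCode ((wordOf c).take j)

theorem mem_branchQueries {s c j : ℕ} (hc : c ≤ s) (hj : j < (wordOf c).length + 1) :
    wordCode ((wordOf c).take j) ∈ branchQueries s :=
  List.mem_flatMap.mpr ⟨c, List.mem_range.mpr (by omega),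
    List.mem_map.mpr ⟨j, List.mem_range.mpr hj, rfl⟩⟩

/-- The bound `s` on the candidates makes the bit depend on a finite part of `t`, so it commutes
with limits of `t` for fixed `s`. -/
theorem branchBit_congr {t t' : Baire} {s : ℕ} (h : ∀ k ∈ branchQueries s, t k = t' k) (i : ℕ) :
    branchBit t s i = branchBit t' s i := by
  have : bestBranch t s = bestBranch t' s := Nat.findGreatest_congr fun c hc =>
    and_congr_right fun _ => forall₂_congr fun j hj => by rw [h _ (mem_branchQueries hc hj)]
  rw [branchBit, branchBit, this]

theorem primrec_wordOf : Primrec wordOf :=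
  Primrec.option_getD.comp Primrec.decode (Primrec.const [])

theorem primrec_wordCode : Primrec wordCode := by
  have hb : Primrec Bool.toNat := Primrec.dom_finite _
  have h : Primrec₂ fun (_ : List Bool) (x : ℕ × Bool) => 2 * x.1 + 1 + x.2.toNat :=
    Primrec.nat_add.comp (Primrec.succ.comp (Primrec.nat_mul.comp (Primrec.const 2)
      (Primrec.fst.comp Primrec.snd))) (hb.comp (Primrec.snd.comp Primrec.snd))
  exact Primrec.list_foldl Primrec.id (Primrec.const 0) h

theorem primrec_prefixCode : Primrec₂ fun c j => wordCode ((wordOf c).take j) :=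
  primrec_wordCode.comp (Primrec.list_take.comp Primrec.snd (primrec_wordOf.comp Primrec.fst))

theorem primrec_branchQueries : Primrec branchQueries :=
  Primrec.list_flatMap (Primrec.list_range.comp Primrec.succ)
    (Primrec.list_map (Primrec.list_range.comp
      (Primrec.succ.comp (Primrec.list_length.comp (primrec_wordOf.comp Primrec.snd))))
      (primrec_prefixCode.comp (Primrec.snd.comp Primrec.fst) Primrec.snd))

/-- The full list `zs` selects the row that is read, while its head also bounds the search, so the
queries are finitely many and computable. -/
theorem exists_oraclePartrec_branchBit :
    ∃ Φ, OraclePartrec Φ ∧ ∀ (p : Baire) n,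
      baireOfFamily (fun zs => branchBit (fun k => p (rowIndex zs k)) zs.headI) n ∈ Φ p n := by
  let zs : ℕ → List ℕ := fun n => Denumerable.ofNat (List ℕ) n.unpair.1
  have hzs : Primrec zs := primrec_familyList
  have hhead : Primrec fun n => (zs n).headI := Primrec.list_headI.comp hzs
  have hread : Primrec₂ fun (x : ℕ × List ℕ) (k : ℕ) => (x.2[rowIndex (zs x.1) k]?).getD 0 :=
    Primrec.option_getD.comp (Primrec.list_getElem?.comp (Primrec.snd.comp Primrec.fst)
      (primrec_rowIndex.comp (hzs.comp (Primrec.fst.comp Primrec.fst)) Primrec.snd))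
      (Primrec.const 0)
  have hone : PrimrecRel fun (j : ℕ) (y : (ℕ × List ℕ) × ℕ) =>
      (y.1.2[rowIndex (zs y.1.1) (wordCode ((wordOf y.2).take j))]?).getD 0 = 1 :=
    Primrec.eq.comp (hread.comp (Primrec.fst.comp Primrec.snd)
      (primrec_prefixCode.comp (Primrec.snd.comp Primrec.snd) Primrec.fst)) (Primrec.const 1)
  have hbranch : PrimrecRel fun (x : ℕ × List ℕ) (c : ℕ) =>
      IsBranch (fun k => (x.2[rowIndex (zs x.1) k]?).getD 0) c := by
    have hall := hone.forall_nat_lt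
    exact PrimrecPred.and
      (Primrec.eq.comp (Primrec.encode.comp (primrec_wordOf.comp Primrec.snd)) Primrec.snd)
      (hall.comp (Primrec.succ.comp (Primrec.list_length.comp (primrec_wordOf.comp Primrec.snd)))
        Primrec.id)
  have hbest : Primrec fun x : ℕ × List ℕ =>
      bestBranch (fun k => (x.2[rowIndex (zs x.1) k]?).getD 0) (zs x.1).headI :=
    Primrec.nat_findGreatest (hhead.comp Primrec.fst) hbranch
  have hb : Primrec Bool.toNat := Primrec.dom_finite _
  have hf : Primrec₂ fun (n : ℕ) (l : List ℕ) =>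
      branchBit (fun k => (l[rowIndex (zs n) k]?).getD 0) (zs n).headI n.unpair.2 :=
    hb.comp ((Primrec.list_getD false).comp (primrec_wordOf.comp hbest)
      (Primrec.snd.comp (Primrec.unpair.comp Primrec.fst)))
  have hQ : Primrec fun n => (branchQueries (zs n).headI).map (rowIndex (zs n)) :=
    Primrec.list_map (primrec_branchQueries.comp hhead)
      (primrec_rowIndex.comp (hzs.comp Primrec.fst) Primrec.snd)
  refine OraclePartrec.of_queries (F := fun p => baireOfFamily fun zs =>
    branchBit (fun k => p (rowIndex zs k)) zs.headI) hQ hf fun p n l hl => ?_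
  refine branchBit_congr (fun k hk => ?_) _
  rw [hl _ (List.mem_map.mpr ⟨k, hk, rfl⟩)]
  rfl

/-- Only finitely many words are shorter than `L`, so a branch of large enough code is long. An
infinite tree has a node `w` of such a code; once the approximation is correct on the prefixes of
`w`, the greatest branch has at least that code. Requiring canonical codes in `IsBranch` prevents
the empty word from winning under a large number. -/
theorem eventually_length_bestBranch {r q : Baire} {T : BinWordTree}
    (hr : Tendsto (baireRow r) atTop (𝓝 q)) (hq : treeRep.IsName q T) (hT : T.nodes.Infinite)
    (L : ℕ) : ∀ᶠ z in atTop, IsBranch (baireRow r z) (bestBranch (baireRow r z) z) ∧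
      L ≤ (wordOf (bestBranch (baireRow r z) z)).length := by
  have hshort := (List.finite_length_lt Bool L).image (Encodable.encode : List Bool → ℕ)
  obtain ⟨b, hb⟩ := hshort.bddAbove
  obtain ⟨_, ⟨w, hw, rfl⟩, hbw⟩ := (hT.image Encodable.encode_injective.injOn).exists_gt b
  have hev : ∀ᶠ z in atTop, ∀ k ∈ (branchQueries (Encodable.encode w)).toFinset,
      r (Nat.pair z k) = q k :=
    (Finset.eventually_all _).mpr fun k _ => tendsto_baireRow_iff.mp hr k
  filter_upwards [hev, eventually_ge_atTop (Encodable.encode w)] with z hz hzw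
  have hgood : IsBranch (baireRow r z) (Encodable.encode w) := by
    refine ⟨by rw [wordOf_encode], fun j hj => ?_⟩
    rw [baireRow, hz _ (List.mem_toFinset.mpr (mem_branchQueries le_rfl hj)), hq, if_pos]
    rw [wordOf_encode]
    exact T.closed _ _ (List.take_prefix j w) hw
  have hspec : IsBranch (baireRow r z) (bestBranch (baireRow r z) z) :=
    Nat.findGreatest_spec hzw hgood
  refine ⟨hspec, ?_⟩
  by_contra! hlt
  have h1 := hb ⟨_, hlt, rfl⟩
  rw [hspec.1] at h1
  have h2 : Encodable.encode w ≤ bestBranch (baireRow r z) z := Nat.le_findGreatest hzw hgood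
  omega

/-- The approximating branches need not lie in `T`. For each `L`, however, the approximation is
eventually correct on all words of length `L`, so the prefix of length `L` of a long enough branch
does lie in `T`; along `M` this prefix is eventually that of the limit. -/
theorem WKL_isSolution_of_limit {r q s : Baire} {T : BinWordTree}
    (hr : Tendsto (baireRow r) atTop (𝓝 q)) (hq : treeRep.IsName q T) (hT : T.nodes.Infinite)
    {M : Set ℕ} (hM : M.Infinite)
    (hs : ∀ i, ∀ᶠ z in atTop, z ∈ M → branchBit (baireRow r z) z i = s i) :
    ∃ y ∈ WKL.sol T, cantorRep.IsName s y := by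
  have hMf := Nat.frequently_atTop_iff_infinite.mpr hM
  -- Each `s i` is a bit that is attained along `M`, so decoding by `s i = 1` loses nothing.
  refine ⟨fun i => decide (s i = 1), ⟨hT, fun L => ?_⟩, fun i => ?_⟩
  · have hwords : ∀ᶠ z in atTop, ∀ w ∈ (List.finite_length_eq Bool L).toFinset,
        r (Nat.pair z (wordCode w)) = q (wordCode w) :=
      (Finset.eventually_all _).mpr fun w _ => tendsto_baireRow_iff.mp hr _
    have hbits : ∀ᶠ z in atTop, ∀ i ∈ Finset.range L,
        z ∈ M → branchBit (baireRow r z) z i = s i :=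
      (Finset.eventually_all _).mpr fun i _ => hs i
    obtain ⟨z, hz, ⟨hbr, hlen⟩, hwd, hbit⟩ := (hMf.and_eventually
      ((eventually_length_bestBranch hr hq hT L).and (hwords.and hbits))).exists
    set w := wordOf (bestBranch (baireRow r z) z) with hw
    have htake : (List.range L).map (fun i => decide (s i = 1)) = w.take L := by
      refine List.ext_getElem (by simpa using hlen) fun i h1 h2 => ?_
      simp only [List.length_map, List.length_range] at h1
      have := hbit i (Finset.mem_range.mpr h1) hz
      rw [branchBit, ← hw, List.getD_eq_getElem _ _ (by omega)] at this
      simp only [List.getElem_map, List.getElem_range, List.getElem_take, ← this]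
      cases w[i] <;> simp
    rw [htake]
    have h1 := hbr.2 L (Nat.lt_succ_of_le hlen)
    rw [baireRow, hwd _ (by simpa using hlen), hq] at h1
    by_contra hne
    rw [if_neg hne] at h1
    exact absurd h1 (by decide)
  · obtain ⟨z, hz, h⟩ := (hMf.and_eventually (hs i)).exists
    have hz' := h hz
    rw [branchBit] at hz'
    simp only [← hz']
    cases (wordOf (bestBranch (baireRow r z) z)).getD i false <;> rfl

/-- The jumps of weak Kőnig's lemma reduce to Ramsey's theorem, and from the second one on they
reduce to the stable version. -/
theorem WKL_iterJump_le {g : Problem} (m : ℕ)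
    (hg : g = RT (m + 3) 2 ∨ g = SRT (m + 3) 2 ∧ 0 < m) :
    WeihrauchReducible (WKL.iterJump (m + 1)) g := by
  rw [Problem.iterJump_eq]
  refine weihrauchReducible_of_iterated_limit m exists_oraclePartrec_branchBit ?_
    (hg.imp_right fun h => ⟨h.1, ?_⟩)
  · rintro p T ⟨y, hT, -⟩ hp
    -- Only `m` of the `m + 1` jumps are unfolded into iterated limits. The remaining one gives the
    -- rows of `r`, which approximate the tree and are indexed by `z₀`.
    obtain ⟨r, ⟨q, hr, hq⟩, hlim⟩ :=
      NamingSystem.isName_iterate_jump (m := m) (δ := treeRep.jump) hp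
    refine ⟨fun z => branchBit (baireRow r z) z, fun z i => ?_, fun i => ?_,
      fun M s hM hs => WKL_isSolution_of_limit hr hq hT hM hs⟩
    · obtain ⟨b, hb⟩ := ((branchQueries z).map (Nat.pair z)).toFinset.exists_nat_subset_range
      refine (hlim b).mono fun ys _ hys => branchBit_congr (fun k hk => ?_) i
      exact hys _ (Finset.mem_range.mp (hb (List.mem_toFinset.mpr
        (List.mem_map.mpr ⟨k, hk, rfl⟩))))
    · refine (Set.finite_Iic 1).subset ?_
      rintro _ ⟨z, rfl⟩
      exact Bool.toNat_le _
  · intro p T _ hp ws hws i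
    dsimp only at hp
    rw [Function.iterate_succ_apply'] at hp
    obtain ⟨p', hp', -⟩ := hp
    -- This is where `0 < m` is needed: the bound `z` of the search is already fixed when `y` tends
    -- to infinity. For `m = 0` the bound would be `y` itself, and the branches might oscillate.
    obtain ⟨z, ws', rfl⟩ := List.exists_cons_of_length_pos (hws ▸ h.2)
    have hev : ∀ᶠ y in atTop, ∀ k ∈ (branchQueries z).toFinset,
        p (Nat.pair y (rowIndex (z :: ws') k)) = p' (rowIndex (z :: ws') k) :=
      (Finset.eventually_all _).mpr fun k _ => tendsto_baireRow_iff.mp hp' _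
    refine ⟨branchBit (fun k => p' (rowIndex (z :: ws') k)) z i, ?_⟩
    filter_upwards [hev] with y hy
    refine branchBit_congr (s := z) (fun k hk => ?_) i
    rw [rowIndex_concat]
    exact hy k (List.mem_toFinset.mpr hk)

theorem corollary3p20 :
    WeihrauchReducible limProblem (SRT 3 2) ∧
    WeihrauchReducible WKL.jump (RT 3 2) ∧
    ∀ n : ℕ, 2 ≤ n → WeihrauchReducible (WKL.iterJump n) (SRT (n + 2) 2) := by
  refine ⟨lim_le_SRT, WKL_iterJump_le 0 (.inl rfl), fun n hn => ?_⟩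
  obtain ⟨m, rfl⟩ : ∃ m, n = m + 1 := ⟨n - 1, by omega⟩
  exact WKL_iterJump_le m (.inr ⟨rfl, by omega⟩)
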